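/- Let $\mathcal H$ be a complex separable Hilbert space, with trace class operators $\mathcal T(\mathcal H)$. A state is a positive trace class operator of trace one; an effect is a bounded operator $A$ with $0\le A\le I$. An operation is a completely positive linear map $\Phi$ on $\mathcal T(\mathcal H)$ with $0\le \operatorname{tr}[\Phi(\varrho)]\le 1$ for every state $\varrho$. An instrument is a $\sigma$-additive map $X\mapsto\mathcal J_X$ from a $\sigma$-algebra of subsets of an outcome set $\Omega$ to the operations such that $\operatorname{tr}[\mathcal J_\Omega(\varrho)]=1$ for every state $\varrho$. Two operations $\Phi,\Psi$ are coexistent if there are an instrument $\mathcal J$ and measurable sets $X,Y$ with $\mathcal J_X=\Phi$ and $\mathcal J_Y=\Psi$. For an effect $A$ and a state $\xi$, let $\Phi_A^{\xi}(\varrho)=\operatorname{tr}[\varrho A]\,\xi$ be the conditional state preparator. Let $A,B$ be effects and let $\xi_1\neq\xi_2$ be pure states, i.e. $\xi_i=|\phi_i\rangle\langle\phi_i|$ for unit vectors $\phi_i\in\mathcal H$. If $\Phi_A^{\xi_1}$ and $\Phi_B^{\xi_2}$ are coexistent, then $A+B\le I$. -/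

import Mathlib

open scoped ComplexOrder InnerProductSpace

universe u v

noncomputable section

namespace QuantumOp

variable {H : Type u} [NormedAddCommGroup H] [InnerProductSpace ℂ H] [CompleteSpace H]

/-! ### Trace class operators and the trace -/

/-- The index set of a fixed orthonormal basis of `H`. -/
def basisIndex (H : Type u) [NormedAddCommGroup H] [InnerProductSpace ℂ H] [CompleteSpace H] :
    Set H :=
  (exists_hilbertBasis ℂ H).choose

/-- A fixed orthonormal basis of `H`. -/
def basis (H : Type u) [NormedAddCommGroup H] [InnerProductSpace ℂ H] [CompleteSpace H] :
    HilbertBasis (basisIndex H) ℂ H :=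
  (exists_hilbertBasis ℂ H).choose_spec.choose

/-- `T` is of trace class: the absolute value `|T| = √(T* T)` has finite trace,
i.e. `∑ ⟨b, |T| b⟩ < ∞` over an orthonormal basis. -/
def IsTraceClass (T : H →L[ℂ] H) : Prop :=
  Summable fun i => ⟪basis H i, CFC.abs T (basis H i)⟫_ℂ

/-- Auxiliary: `T = ∑ₖ |xₖ⟩⟨yₖ|` with `∑ₖ ‖xₖ‖ ‖yₖ‖ < ∞`.  This is only used to prove that the
trace class operators form a linear space. -/
def HasNuclearRep (T : H →L[ℂ] H) : Prop :=
  ∃ (κ : Type u) (x y : κ → H), (Summable fun k => ‖x k‖ * ‖y k‖) ∧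
    ∀ w, HasSum (fun k => ⟪y k, w⟫_ℂ • x k) (T w)

theorem hasSum_nuclear {κ : Type u} {x y : κ → H} {T : H →L[ℂ] H}
    (hs : Summable fun k => ‖x k‖ * ‖y k‖)
    (hT : ∀ w, HasSum (fun k => ⟪y k, w⟫_ℂ • x k) (T w))
    {ι : Type*} (b : HilbertBasis ι ℂ H) :
    HasSum (fun i => ⟪b i, T (b i)⟫_ℂ) (∑' k, ⟪y k, x k⟫_ℂ) := by
  have hsum : ∀ (z : H) (s : Finset ι), ∑ i ∈ s, ‖⟪b i, z⟫_ℂ‖ ^ 2 ≤ ‖z‖ ^ 2 := fun z s =>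
    b.orthonormal.sum_inner_products_le z
  have hbound : ∀ k (s : Finset ι),
      ∑ i ∈ s, ‖⟪y k, b i⟫_ℂ * ⟪b i, x k⟫_ℂ‖ ≤ ‖x k‖ * ‖y k‖ := by
    intro k s
    calc ∑ i ∈ s, ‖⟪y k, b i⟫_ℂ * ⟪b i, x k⟫_ℂ‖
        = ∑ i ∈ s, ‖⟪b i, x k⟫_ℂ‖ * ‖⟪b i, y k⟫_ℂ‖ := by
          refine Finset.sum_congr rfl fun i _ => ?_
          rw [norm_mul, norm_inner_symm (y k), mul_comm]
      _ ≤ √(∑ i ∈ s, ‖⟪b i, x k⟫_ℂ‖ ^ 2) * √(∑ i ∈ s, ‖⟪b i, y k⟫_ℂ‖ ^ 2) :=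
          Real.sum_mul_le_sqrt_mul_sqrt _ _ _
      _ ≤ ‖x k‖ * ‖y k‖ := by
          gcongr
          · exact Real.sqrt_le_iff.2 ⟨norm_nonneg _, hsum _ _⟩
          · exact Real.sqrt_le_iff.2 ⟨norm_nonneg _, hsum _ _⟩
  have hprod : Summable fun p : κ × ι => ⟪y p.1, b p.2⟫_ℂ * ⟪b p.2, x p.1⟫_ℂ := by
    refine Summable.of_norm ?_
    refine (summable_prod_of_nonneg (fun _ => norm_nonneg _)).2 ⟨fun k => ?_, ?_⟩
    · exact summable_of_sum_le (fun _ => norm_nonneg _) (hbound k)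
    · refine Summable.of_nonneg_of_le (fun k => tsum_nonneg fun _ => norm_nonneg _)
        (fun k => ?_) hs
      exact Real.tsum_le_of_sum_le (fun _ => norm_nonneg _) (hbound k)
  have h1 : ∀ k, HasSum (fun i => ⟪y k, b i⟫_ℂ * ⟪b i, x k⟫_ℂ) ⟪y k, x k⟫_ℂ := fun k =>
    b.hasSum_inner_mul_inner _ _
  have h2 : ∀ i, HasSum (fun k => ⟪y k, b i⟫_ℂ * ⟪b i, x k⟫_ℂ) ⟪b i, T (b i)⟫_ℂ := by
    intro i
    have := (hT (b i)).mapL (innerSL ℂ (b i))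
    simpa [inner_smul_right] using this
  have h3 := hprod.hasSum
  have h4 : HasSum (fun k => ⟪y k, x k⟫_ℂ) (∑' p : κ × ι, ⟪y p.1, b p.2⟫_ℂ * ⟪b p.2, x p.1⟫_ℂ) :=
    h3.prod_fiberwise h1
  have h5 : HasSum (fun p : ι × κ => ⟪y p.2, b p.1⟫_ℂ * ⟪b p.1, x p.2⟫_ℂ)
      (∑' p : κ × ι, ⟪y p.1, b p.2⟫_ℂ * ⟪b p.2, x p.1⟫_ℂ) :=
    (Equiv.prodComm ι κ).hasSum_iff.2 h3
  rw [h4.tsum_eq]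
  exact h5.prod_fiberwise h2

/-- Factorization: if `‖f x‖ ≤ ‖e x‖` for all `x` then `f = W e` for a bounded `W`. -/
theorem exists_factor (f e : H →L[ℂ] H) (h : ∀ x, ‖f x‖ ≤ ‖e x‖) :
    ∃ W : H →L[ℂ] H, W ∘L e = f := by
  let K : Submodule ℂ H := (LinearMap.range e.toLinearMap).topologicalClosure
  have : CompleteSpace K := (Submodule.isClosed_topologicalClosure _).completeSpace_coe
  have hmem : ∀ x, e x ∈ K := fun x => Submodule.le_topologicalClosure _ ⟨x, rfl⟩
  let e' : H →ₗ[ℂ] K := e.toLinearMap.codRestrict K hmem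
  have hd : DenseRange e' := by
    intro z
    rw [Topology.IsInducing.subtypeVal.closure_eq_preimage_closure_image]
    have hr : (Subtype.val '' Set.range e' : Set H) = (LinearMap.range e.toLinearMap : Set H) := by
      ext w
      simp [e', Set.mem_image]
    have hz : (z : H) ∈ closure (Subtype.val '' Set.range e' : Set H) := by
      rw [hr]
      exact z.2
    exact hz
  have hn : ∃ C, ∀ x, ‖f.toLinearMap x‖ ≤ C * ‖e' x‖ := ⟨1, fun x => by
    simpa [e'] using h x⟩
  refine ⟨(f.toLinearMap.extendOfNorm e') ∘L K.orthogonalProjectionOnto, ?_⟩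
  ext x
  have h1 : K.orthogonalProjectionOnto (e x) = e' x := by
    exact K.orthogonalProjectionOnto_mem_subspace_eq_self ⟨e x, hmem x⟩
  have h2 := LinearMap.extendOfNorm_eq hd hn x
  simpa [h1] using h2

theorem HasNuclearRep.comp_left {T : H →L[ℂ] H} (hT : HasNuclearRep T) (W : H →L[ℂ] H) :
    HasNuclearRep (W ∘L T) := by
  obtain ⟨κ, x, y, hs, hT⟩ := hT
  refine ⟨κ, fun k => W (x k), y, ?_, fun w => ?_⟩
  · refine Summable.of_nonneg_of_le (fun k => by positivity) (fun k => ?_) (hs.mul_left ‖W‖)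
    rw [← mul_assoc]
    gcongr
    exact W.le_opNorm _
  · simpa using (hT w).mapL W

theorem HasNuclearRep.comp_right {T : H →L[ℂ] H} (hT : HasNuclearRep T) (W : H →L[ℂ] H) :
    HasNuclearRep (T ∘L W) := by
  obtain ⟨κ, x, y, hs, hT⟩ := hT
  refine ⟨κ, x, fun k => ContinuousLinearMap.adjoint W (y k), ?_, fun w => ?_⟩
  · refine Summable.of_nonneg_of_le (fun k => by positivity) (fun k => ?_)
      (hs.mul_left ‖ContinuousLinearMap.adjoint W‖)
    calc ‖x k‖ * ‖ContinuousLinearMap.adjoint W (y k)‖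
        ≤ ‖x k‖ * (‖ContinuousLinearMap.adjoint W‖ * ‖y k‖) := by
          gcongr
          exact ContinuousLinearMap.le_opNorm _ _
      _ = _ := by ring
  · simpa [ContinuousLinearMap.adjoint_inner_left] using hT (W w)

theorem HasNuclearRep.add {S T : H →L[ℂ] H} (hS : HasNuclearRep S) (hT : HasNuclearRep T) :
    HasNuclearRep (S + T) := by
  obtain ⟨κ, x, y, hs, hS⟩ := hS
  obtain ⟨μ, x', y', hs', hT⟩ := hT
  refine ⟨κ ⊕ μ, Sum.elim x x', Sum.elim y y', ?_, fun w => ?_⟩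
  · exact Summable.sum (f := fun k => ‖Sum.elim x x' k‖ * ‖Sum.elim y y' k‖) hs hs'
  · exact HasSum.sum (f := fun k => ⟪Sum.elim y y' k, w⟫_ℂ • Sum.elim x x' k) (hS w) (hT w)

theorem norm_abs_apply (T : H →L[ℂ] H) (x : H) : ‖CFC.abs T x‖ = ‖T x‖ := by
  have hsa : IsSelfAdjoint (CFC.abs T) := (CFC.abs_nonneg T).isSelfAdjoint
  have h : ∀ S : H →L[ℂ] H, ⟪S x, S x⟫_ℂ = ⟪x, (star S * S) x⟫_ℂ := fun S => by
    simp [ContinuousLinearMap.star_eq_adjoint, ContinuousLinearMap.adjoint_inner_right]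
  have h1 : ⟪CFC.abs T x, CFC.abs T x⟫_ℂ = ⟪T x, T x⟫_ℂ := by
    rw [h, h, hsa.star_eq, CFC.abs_mul_abs]
  rw [inner_self_eq_norm_sq_to_K, inner_self_eq_norm_sq_to_K] at h1
  have h2 : ‖CFC.abs T x‖ ^ 2 = ‖T x‖ ^ 2 := by exact_mod_cast h1
  exact (sq_eq_sq₀ (norm_nonneg _) (norm_nonneg _)).1 h2

theorem IsTraceClass.hasNuclearRep {T : H →L[ℂ] H} (hT : IsTraceClass T) : HasNuclearRep T := by
  obtain ⟨V, hV⟩ := exists_factor T (CFC.abs T) fun x => (norm_abs_apply T x).ge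
  let R : H →L[ℂ] H := CFC.sqrt (CFC.abs T)
  have hRR : R * R = CFC.abs T := CFC.sqrt_mul_sqrt_self _ (CFC.abs_nonneg T)
  have hRsa : IsSelfAdjoint R := (CFC.sqrt_nonneg (CFC.abs T)).isSelfAdjoint
  have hRi : ∀ a b, ⟪R a, b⟫_ℂ = ⟪a, R b⟫_ℂ := fun a b => by
    have h1 : ContinuousLinearMap.adjoint R = R := hRsa.star_eq
    rw [← ContinuousLinearMap.adjoint_inner_right, h1]
  rw [← hV]
  refine HasNuclearRep.comp_left ⟨basisIndex H, fun i => R (basis H i), fun i => R (basis H i),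
    ?_, fun w => ?_⟩ V
  · refine (Complex.hasSum_re hT.hasSum).summable.congr fun i => ?_
    rw [← hRR, mul_apply_eq_comp, ← hRi, inner_self_eq_norm_sq_to_K, ← sq]
    norm_cast
  · have h1 := ((basis H).hasSum_repr (R w)).mapL R
    rw [← hRR]
    simpa [HilbertBasis.repr_apply_apply, hRi] using h1

theorem HasNuclearRep.isTraceClass {T : H →L[ℂ] H} (hT : HasNuclearRep T) : IsTraceClass T := by
  obtain ⟨W, hW⟩ := exists_factor (CFC.abs T) T fun x => (norm_abs_apply T x).le
  obtain ⟨κ, x, y, hs, hT⟩ := hT.comp_left W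
  rw [hW] at hT
  exact (hasSum_nuclear hs hT (basis H)).summable

theorem isTraceClass_iff {T : H →L[ℂ] H} : IsTraceClass T ↔ HasNuclearRep T :=
  ⟨IsTraceClass.hasNuclearRep, HasNuclearRep.isTraceClass⟩

/-- The linear space of trace class operators on `H`. -/
def traceClass (H : Type u) [NormedAddCommGroup H] [InnerProductSpace ℂ H] [CompleteSpace H] :
    Submodule ℂ (H →L[ℂ] H) where
  carrier := {T | IsTraceClass T}
  add_mem' hS hT := (hS.hasNuclearRep.add hT.hasNuclearRep).isTraceClass
  zero_mem' := by simp [IsTraceClass, summable_zero]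
  smul_mem' c T hT := by
    have h := (hT.hasNuclearRep.comp_left (c • ContinuousLinearMap.id ℂ H)).isTraceClass
    simpa using h

theorem mem_traceClass {T : H →L[ℂ] H} : T ∈ traceClass H ↔ IsTraceClass T := Iff.rfl

theorem comp_mem_traceClass {T : H →L[ℂ] H} (hT : T ∈ traceClass H) (A : H →L[ℂ] H) :
    T ∘L A ∈ traceClass H :=
  (hT.hasNuclearRep.comp_right A).isTraceClass

theorem rankOne_mem_traceClass (x y : H) : InnerProductSpace.rankOne ℂ x y ∈ traceClass H :=
  HasNuclearRep.isTraceClass ⟨PUnit, fun _ => x, fun _ => y, (hasSum_unique _).summable,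
    fun w => by simpa using hasSum_unique (fun _ : PUnit => ⟪y, w⟫_ℂ • x)⟩

/-- The trace `∑ ⟨b, T b⟩` over an orthonormal basis. -/
def trace (T : H →L[ℂ] H) : ℂ := ∑' i, ⟪basis H i, T (basis H i)⟫_ℂ

/-- The series defining the trace of a trace class operator converges (absolutely), and its sum
does not depend on the orthonormal basis. -/
theorem hasSum_trace {T : H →L[ℂ] H} (hT : T ∈ traceClass H) {ι : Type*}
    (b : HilbertBasis ι ℂ H) : HasSum (fun i => ⟪b i, T (b i)⟫_ℂ) (trace T) := by
  obtain ⟨κ, x, y, hs, hT⟩ := hT.hasNuclearRep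
  have h := (hasSum_nuclear hs hT (basis H)).tsum_eq
  rw [trace, h]
  exact hasSum_nuclear hs hT b

theorem trace_add {S T : H →L[ℂ] H} (hS : S ∈ traceClass H) (hT : T ∈ traceClass H) :
    trace (S + T) = trace S + trace T := by
  have h := (hasSum_trace hS (basis H)).add (hasSum_trace hT (basis H))
  rw [← h.tsum_eq]
  simp [trace]

theorem trace_smul (c : ℂ) (T : H →L[ℂ] H) : trace (c • T) = c * trace T := by
  simp [trace, tsum_mul_left]

/-- The trace norm `‖T‖₁ = tr |T|`. -/
def traceNorm (T : H →L[ℂ] H) : ℝ := (trace (CFC.abs T)).re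

/-! ### States and effects -/

/-- A state: a positive trace class operator of trace one. -/
def IsState (ρ : traceClass H) : Prop :=
  0 ≤ (ρ : H →L[ℂ] H) ∧ trace (ρ : H →L[ℂ] H) = 1

/-- A pure state: `ξ = |φ⟩⟨φ|` for some unit vector `φ`. -/
def IsPureState (ξ : traceClass H) : Prop :=
  ∃ φ : H, ‖φ‖ = 1 ∧ (ξ : H →L[ℂ] H) = InnerProductSpace.rankOne ℂ φ φ

/-- An effect: `0 ≤ A ≤ I`. -/
def IsEffect (A : H →L[ℂ] H) : Prop := 0 ≤ A ∧ A ≤ 1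

/-! ### Operations and instruments -/

/-- Positivity of an operator on `H ⊗ ℂⁿ`, written as an `n × n` block matrix of operators. -/
def BlockPositive {n : ℕ} (T : Fin n → Fin n → traceClass H) : Prop :=
  ∀ x : Fin n → H, 0 ≤ ∑ i, ∑ j, ⟪x i, (T i j : H →L[ℂ] H) (x j)⟫_ℂ

/-- Complete positivity: `Φ ⊗ idₙ` preserves positivity for every `n`. -/
def IsCompletelyPositive (Φ : traceClass H →ₗ[ℂ] traceClass H) : Prop :=
  ∀ (n : ℕ) (T : Fin n → Fin n → traceClass H), BlockPositive T →
    BlockPositive fun i j => Φ (T i j)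

/-- An operation: a completely positive linear map `Φ` on the trace class operators with
`0 ≤ tr Φ(ρ) ≤ 1` for every state `ρ`. -/
structure IsOperation (Φ : traceClass H →ₗ[ℂ] traceClass H) : Prop where
  completelyPositive : IsCompletelyPositive Φ
  trace_nonneg : ∀ ρ, IsState ρ → 0 ≤ trace (Φ ρ : H →L[ℂ] H)
  trace_le_one : ∀ ρ, IsState ρ → trace (Φ ρ : H →L[ℂ] H) ≤ 1

/-- An instrument on the measurable space `Ω`: a normalized, `σ`-additive, operation valued set
function on the measurable sets (`σ`-additivity is pointwise convergence in trace norm; the values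
of `toFun` on non-measurable sets play no role). -/
structure Instrument (Ω : Type v) [MeasurableSpace Ω] (H : Type u) [NormedAddCommGroup H]
    [InnerProductSpace ℂ H] [CompleteSpace H] where
  toFun : Set Ω → traceClass H →ₗ[ℂ] traceClass H
  isOperation : ∀ X, MeasurableSet X → IsOperation (toFun X)
  sigma_additive : ∀ X : ℕ → Set Ω, (∀ n, MeasurableSet (X n)) →
    Pairwise (Function.onFun Disjoint X) → ∀ T : traceClass H,
      Filter.Tendsto
        (fun N => traceNorm
          ((toFun (⋃ n, X n) T - ∑ n ∈ Finset.range N, toFun (X n) T : traceClass H) :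
            H →L[ℂ] H))
        Filter.atTop (nhds 0)
  normalized : ∀ ρ, IsState ρ → trace (toFun Set.univ ρ : H →L[ℂ] H) = 1

/-- The range of an instrument. -/
def Instrument.range {Ω : Type v} [MeasurableSpace Ω] (J : Instrument Ω H) :
    Set (traceClass H →ₗ[ℂ] traceClass H) :=
  {Φ | ∃ X, MeasurableSet X ∧ J.toFun X = Φ}

/-- Two operations are coexistent if they lie in the range of a common instrument. -/
def Coexistent (Φ Ψ : traceClass H →ₗ[ℂ] traceClass H) : Prop :=
  ∃ (Ω : Type v) (_ : MeasurableSpace Ω) (J : Instrument Ω H), Φ ∈ J.range ∧ Ψ ∈ J.range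

/-- The conditional state preparator `Φ_A^ξ : T ↦ tr(T A) ξ`. -/
def preparator (A : H →L[ℂ] H) (ξ : traceClass H) : traceClass H →ₗ[ℂ] traceClass H where
  toFun T := trace ((T : H →L[ℂ] H) ∘L A) • ξ
  map_add' S T := by
    rw [← add_smul, ← trace_add (comp_mem_traceClass S.2 A) (comp_mem_traceClass T.2 A)]
    simp [ContinuousLinearMap.add_comp]
  map_smul' c T := by
    rw [RingHom.id_apply, smul_smul, ← trace_smul]
    simp [ContinuousLinearMap.smul_comp]

end QuantumOp

end

open ContinuousLinearMap Filter

namespace QuantumOp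

section

variable {H : Type u} [NormedAddCommGroup H] [InnerProductSpace ℂ H] [CompleteSpace H]

/-! Let `J` be the common instrument, with the two preparators at `X` and `Y`, and feed it ρ =
|ψ⟩⟨ψ| for a unit vector ψ. By monotonicity `J` at `X ∩ Y` sends ρ to a positive operator lying
below multiples of both pure states. Such an operator vanishes on φ⊥ and on χ⊥; since the two rays
differ, it is zero (`eq_zero_of_le_smul_rankOne`). On ρ the events therefore behave as if disjoint:
the output of their union is the sum of the two outputs. Its trace ⟨ψ, Aψ⟩ + ⟨ψ, Bψ⟩ is at most 1,
and as ψ is arbitrary this is the operator inequality.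

The analytic input is finite additivity of `J`. It follows from σ-additivity in trace norm because
the trace norm dominates the operator norm (`norm_apply_le_traceNorm`). -/

theorem nonneg_of_forall_inner {T : H →L[ℂ] H} (h : ∀ x, 0 ≤ ⟪x, T x⟫_ℂ) : 0 ≤ T := by
  rw [nonneg_iff_isPositive, isPositive_iff_complex]
  intro x
  have h1 := h x
  rw [Complex.le_def] at h1
  have h2 : ⟪T x, x⟫_ℂ = (starRingEnd ℂ) ⟪x, T x⟫_ℂ := (inner_conj_symm _ _).symm
  rw [h2]
  generalize ⟪x, T x⟫_ℂ = z at h1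
  exact ⟨Complex.ext (by simp) (by simpa using h1.2.symm), by simpa using h1.1⟩

omit [CompleteSpace H] in
theorem inner_nonneg_of_nonneg {T : H →L[ℂ] H} (h : 0 ≤ T) (x : H) : 0 ≤ ⟪x, T x⟫_ℂ :=
  ((nonneg_iff_isPositive T).1 h).inner_nonneg_right x

/-- A diagonal matrix element of a positive trace class operator is at most its trace. -/
theorem re_inner_le_re_trace {P : H →L[ℂ] H} (hP : 0 ≤ P) (hT : P ∈ traceClass H) {x : H}
    (hx : ‖x‖ = 1) : (⟪x, P x⟫_ℂ).re ≤ (trace P).re := by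
  -- The trace does not depend on the basis, so compute it in one containing `x`: the matrix element
  -- is then one term of a nonnegative series.
  have hon : Orthonormal ℂ ((↑) : ({x} : Set H) → H) := by
    refine ⟨fun i => ?_, fun i j hij => (hij (Subsingleton.elim i j)).elim⟩
    rw [i.2, hx]
  obtain ⟨w, b, hw, hb⟩ := hon.exists_hilbertBasis_extension
  have hs := Complex.hasSum_re (hasSum_trace hT b)
  have h := le_hasSum hs ⟨x, hw rfl⟩ fun j _ => (Complex.le_def.1 (inner_nonneg_of_nonneg hP _)).1
  simpa [hb] using h

theorem abs_mem_traceClass {T : H →L[ℂ] H} (hT : T ∈ traceClass H) :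
    CFC.abs T ∈ traceClass H := by
  have h : CFC.abs (CFC.abs T) = CFC.abs T := CFC.abs_of_nonneg _ (CFC.abs_nonneg T)
  rw [mem_traceClass, IsTraceClass, h]
  exact hT

/-- The operator norm is dominated by the trace norm. -/
theorem norm_apply_le_traceNorm {T : H →L[ℂ] H} (hT : T ∈ traceClass H) (x : H) :
    ‖T x‖ ≤ traceNorm T * ‖x‖ := by
  set P := CFC.abs T with hPdef
  have hP : 0 ≤ P := CFC.abs_nonneg T
  -- With `R` the square root of |T|, ‖T x‖ = ‖R (R x)‖ ≤ ‖R‖² ‖x‖, and ‖R‖² is bounded by the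
  -- diagonal elements of |T|, hence by its trace.
  let R : H →L[ℂ] H := CFC.sqrt P
  have hRR : R * R = P := CFC.sqrt_mul_sqrt_self _ hP
  have hRsa : adjoint R = R := (CFC.sqrt_nonneg P).isSelfAdjoint.star_eq
  have hRsq : ∀ y, ((‖R y‖ ^ 2 : ℝ) : ℂ) = ⟪y, P y⟫_ℂ := fun y => by
    rw [← hRR, mul_apply_eq_comp, ← adjoint_inner_left, hRsa, inner_self_eq_norm_sq_to_K]
    norm_cast
  have hunit : ∀ y, ‖y‖ = 1 → ‖R y‖ ^ 2 ≤ traceNorm T := fun y hy => by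
    have h := re_inner_le_re_trace hP (abs_mem_traceClass hT) hy
    rw [← hRsq, Complex.ofReal_re] at h
    exact h
  by_cases hx : x = 0
  · simp [hx]
  have ht : 0 ≤ traceNorm T :=
    (sq_nonneg _).trans (hunit ((‖x‖⁻¹ : ℂ) • x) (by simp [norm_smul, hx]))
  have hR : ‖R‖ ≤ √(traceNorm T) := by
    exact opNorm_le_of_unit_norm (Real.sqrt_nonneg _) fun y hy => Real.le_sqrt_of_sq_le (hunit y hy)
  rw [← norm_abs_apply, ← hPdef, ← hRR, mul_apply_eq_comp]
  calc ‖R (R x)‖ ≤ √(traceNorm T) * (√(traceNorm T) * ‖x‖) :=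
        (R.le_of_opNorm_le hR _).trans (by gcongr; exact R.le_of_opNorm_le hR _)
    _ = traceNorm T * ‖x‖ := by rw [← mul_assoc, Real.mul_self_sqrt ht]

/-! ### Pure states, preparators and positivity -/

theorem trace_rankOne (x y : H) : trace (InnerProductSpace.rankOne ℂ x y) = ⟪y, x⟫_ℂ := by
  have h := hasSum_nuclear (κ := PUnit.{u + 1}) (x := fun _ => x) (y := fun _ => y)
    (T := InnerProductSpace.rankOne ℂ x y) (hasSum_unique _).summable
    (fun w => by simp) (basis H)
  rw [trace, h.tsum_eq]
  simp

/-- The pure state `|ψ⟩⟨ψ|` as a trace class operator. -/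
noncomputable def pureState (ψ : H) : traceClass H :=
  ⟨InnerProductSpace.rankOne ℂ ψ ψ, rankOne_mem_traceClass ψ ψ⟩

omit [CompleteSpace H] in
theorem inner_rankOne_self (φ x : H) :
    ⟪x, InnerProductSpace.rankOne ℂ φ φ x⟫_ℂ = ((‖⟪φ, x⟫_ℂ‖ ^ 2 : ℝ) : ℂ) := by
  rw [InnerProductSpace.rankOne_apply, inner_smul_right, ← inner_conj_symm x φ, Complex.mul_conj,
    Complex.normSq_eq_norm_sq]

theorem rankOne_self_nonneg (ψ : H) : 0 ≤ InnerProductSpace.rankOne ℂ ψ ψ :=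
  nonneg_of_forall_inner fun x => by
    rw [inner_rankOne_self]
    exact Complex.zero_le_real.2 (sq_nonneg _)

theorem isState_pureState {ψ : H} (hψ : ‖ψ‖ = 1) : IsState (pureState ψ) :=
  ⟨rankOne_self_nonneg ψ, by simp [pureState, trace_rankOne, inner_self_eq_norm_sq_to_K, hψ]⟩

theorem coe_preparator_apply (A : H →L[ℂ] H) (ξ T : traceClass H) :
    (preparator A ξ T : H →L[ℂ] H) = trace ((T : H →L[ℂ] H) ∘L A) • (ξ : H →L[ℂ] H) :=
  rfl

theorem trace_preparator_pureState (A : H →L[ℂ] H) {ξ : traceClass H}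
    (hξ : trace (ξ : H →L[ℂ] H) = 1) (ψ : H) :
    trace (preparator A ξ (pureState ψ) : H →L[ℂ] H) = ⟪ψ, A ψ⟫_ℂ := by
  have h : (InnerProductSpace.rankOne ℂ ψ ψ : H →L[ℂ] H) ∘L A =
      InnerProductSpace.rankOne ℂ ψ (adjoint A ψ) := by
    ext x
    simp [adjoint_inner_left]
  rw [coe_preparator_apply, trace_smul, hξ, mul_one, pureState, h, trace_rankOne, adjoint_inner_left]

theorem IsCompletelyPositive.map_nonneg {Φ : traceClass H →ₗ[ℂ] traceClass H}
    (hΦ : IsCompletelyPositive Φ) {T : traceClass H} (hT : 0 ≤ (T : H →L[ℂ] H)) :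
    0 ≤ (Φ T : H →L[ℂ] H) := by
  refine nonneg_of_forall_inner fun x => ?_
  have h := hΦ 1 (fun _ _ => T) (fun y => by simpa using inner_nonneg_of_nonneg hT (y 0))
    fun _ => x
  simpa using h

/-! ### Finite additivity and monotonicity of instruments -/

namespace Instrument

variable {Ω : Type v} [MeasurableSpace Ω] (J : Instrument Ω H)

/-- Trace norm convergence implies strong convergence, where limits can be compared vector by
vector. -/
theorem tendsto_sum_apply {X : ℕ → Set Ω} (hX : ∀ n, MeasurableSet (X n))
    (hd : Pairwise (Function.onFun Disjoint X)) (T : traceClass H) (x : H) :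
    Tendsto (fun N => ∑ n ∈ Finset.range N, (J.toFun (X n) T : H →L[ℂ] H) x) atTop
      (nhds ((J.toFun (⋃ n, X n) T : H →L[ℂ] H) x)) := by
  rw [tendsto_iff_norm_sub_tendsto_zero]
  have h := (J.sigma_additive X hX hd T).mul_const ‖x‖
  rw [zero_mul] at h
  refine squeeze_zero (fun _ => norm_nonneg _) (fun N => ?_) h
  refine le_trans (le_of_eq ?_) (norm_apply_le_traceNorm (Subtype.property _) x)
  rw [norm_sub_rev]
  simp [sum_apply]

theorem toFun_empty (T : traceClass H) : J.toFun ∅ T = 0 := by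
  ext x
  have h := J.tendsto_sum_apply (X := fun _ => ∅) (fun _ => .empty)
    (fun _ _ _ => Set.disjoint_empty _) T x
  -- Consecutive partial sums of the constant series differ by its term, so convergence forces that
  -- term to be zero.
  have h1 := (h.comp (tendsto_add_atTop_nat 1)).sub h
  simp only [Function.comp_def, Finset.sum_range_succ, add_sub_cancel_left, sub_self] at h1
  simpa using tendsto_nhds_unique tendsto_const_nhds h1

theorem toFun_union {X Y : Set Ω} (hX : MeasurableSet X) (hY : MeasurableSet Y)
    (hd : Disjoint X Y) (T : traceClass H) :
    J.toFun (X ∪ Y) T = J.toFun X T + J.toFun Y T := by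
  let Z : ℕ → Set Ω := fun n => if n = 0 then X else if n = 1 then Y else ∅
  have hZ : ∀ n, MeasurableSet (Z n) := fun n => by
    dsimp only [Z]
    split_ifs
    exacts [hX, hY, .empty]
  have hZd : Pairwise (Function.onFun Disjoint Z) := fun i j hij => by
    dsimp only [Z, Function.onFun]
    split_ifs <;> first | omega | exact hd | exact hd.symm | simp
  have hU : ⋃ n, Z n = X ∪ Y := by
    ext ω
    simp only [Set.mem_iUnion, Set.mem_union]
    constructor
    · rintro ⟨n, hn⟩
      dsimp only [Z] at hn
      split_ifs at hn
      exacts [.inl hn, .inr hn, hn.elim]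
    · rintro (h | h)
      exacts [⟨0, h⟩, ⟨1, h⟩]
  ext x
  -- From index 2 on the sets are empty, so the shifted partial sums are constant.
  have h := (J.tendsto_sum_apply hZ hZd T x).comp (tendsto_add_atTop_nat 2)
  rw [hU] at h
  have hc : ∀ N, ∑ n ∈ Finset.range (N + 2), (J.toFun (Z n) T : H →L[ℂ] H) x =
      (J.toFun X T : H →L[ℂ] H) x + (J.toFun Y T : H →L[ℂ] H) x := fun N => by
    rw [add_comm N 2, Finset.sum_range_add, Finset.sum_eq_zero (s := Finset.range N), add_zero,
      Finset.sum_range_succ, Finset.sum_range_one]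
    · rfl
    · intro n _
      have : Z (2 + n) = ∅ := by
        dsimp only [Z]
        rw [if_neg (by omega), if_neg (by omega)]
      simp [this, J.toFun_empty]
  simp only [Function.comp_def, hc] at h
  simpa using tendsto_nhds_unique h tendsto_const_nhds

theorem toFun_nonneg {X : Set Ω} (hX : MeasurableSet X) {T : traceClass H}
    (hT : 0 ≤ (T : H →L[ℂ] H)) : 0 ≤ (J.toFun X T : H →L[ℂ] H) :=
  (J.isOperation X hX).completelyPositive.map_nonneg hT

theorem toFun_mono {X Y : Set Ω} (hX : MeasurableSet X) (hY : MeasurableSet Y) (hXY : X ⊆ Y)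
    {T : traceClass H} (hT : 0 ≤ (T : H →L[ℂ] H)) :
    (J.toFun X T : H →L[ℂ] H) ≤ J.toFun Y T := by
  have h := J.toFun_union hX (hY.diff hX) Set.disjoint_sdiff_right T
  rw [Set.union_sdiff_cancel hXY] at h
  rw [h, Submodule.coe_add]
  exact le_add_of_nonneg_right (J.toFun_nonneg (hY.diff hX) hT)

end Instrument

/-! ### Common minorants of distinct pure states -/

/-- A positive operator kills every vector on which its quadratic form vanishes. -/
theorem apply_eq_zero_of_inner_eq_zero {P : H →L[ℂ] H} (hP : 0 ≤ P) {x : H}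
    (h : ⟪x, P x⟫_ℂ = 0) : P x = 0 := by
  let R : H →L[ℂ] H := CFC.sqrt P
  have hRR : R * R = P := CFC.sqrt_mul_sqrt_self _ hP
  have hRsa : adjoint R = R := (CFC.sqrt_nonneg P).isSelfAdjoint.star_eq
  rw [← hRR, mul_apply_eq_comp, ← adjoint_inner_left, hRsa, inner_self_eq_zero] at h
  rw [← hRR, mul_apply_eq_comp, h, map_zero]

/-- On φ⊥ the quadratic form of `P` is squeezed between 0 and that of the rank one operator, which
is 0 there. -/
theorem apply_eq_zero_of_le_smul_rankOne {P : H →L[ℂ] H} (hP : 0 ≤ P) {c : ℂ} {φ : H}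
    (h : P ≤ c • InnerProductSpace.rankOne ℂ φ φ) {x : H} (hx : ⟪φ, x⟫_ℂ = 0) : P x = 0 := by
  refine apply_eq_zero_of_inner_eq_zero hP (le_antisymm ?_ (inner_nonneg_of_nonneg hP x))
  have h1 := inner_nonneg_of_nonneg (sub_nonneg.2 h) x
  simpa [hx, inner_sub_right] using h1

/-- Distinct pure states have no nonzero common positive minorant, up to multiples. -/
theorem eq_zero_of_le_smul_rankOne {P : H →L[ℂ] H} (hP : 0 ≤ P) {c d : ℂ} {φ χ : H}
    (hφ : ‖φ‖ = 1) (hχ : ‖χ‖ = 1)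
    (hne : InnerProductSpace.rankOne ℂ φ φ ≠ InnerProductSpace.rankOne ℂ χ χ)
    (h₁ : P ≤ c • InnerProductSpace.rankOne ℂ φ φ)
    (h₂ : P ≤ d • InnerProductSpace.rankOne ℂ χ χ) : P = 0 := by
  have hφφ : ⟪φ, φ⟫_ℂ = 1 := by simp [inner_self_eq_norm_sq_to_K, hφ]
  have hχχ : ⟪χ, χ⟫_ℂ = 1 := by simp [inner_self_eq_norm_sq_to_K, hχ]
  have hPx : ∀ x, P x = ⟪φ, x⟫_ℂ • P φ := fun x => by
    have h := apply_eq_zero_of_le_smul_rankOne hP h₁ (x := x - ⟪φ, x⟫_ℂ • φ)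
      (by rw [inner_sub_right, inner_smul_right, hφφ, mul_one, sub_self])
    rwa [map_sub, map_smul, sub_eq_zero] at h
  -- The part of φ orthogonal to χ. Since ⟨φ, v⟩ = ‖v‖², vanishing would make φ a unimodular
  -- multiple of χ, with the same projection.
  set v := φ - ⟪χ, φ⟫_ℂ • χ with hv
  have hχv : ⟪χ, v⟫_ℂ = 0 := by
    rw [hv, inner_sub_right, inner_smul_right, hχχ, mul_one, sub_self]
  have hφv : ⟪φ, v⟫_ℂ ≠ 0 := fun h => by
    have hv0 : v = 0 := by
      rw [← inner_self_eq_zero (𝕜 := ℂ)]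
      nth_rewrite 1 [hv]
      rw [inner_sub_left, inner_smul_left, h, hχv, mul_zero, sub_zero]
    have hφχ : φ = ⟪χ, φ⟫_ℂ • χ := sub_eq_zero.1 hv0
    have hmod : ‖⟪χ, φ⟫_ℂ‖ = 1 := by
      have := congrArg norm hφχ
      rwa [norm_smul, hφ, hχ, mul_one, eq_comm] at this
    refine hne ?_
    have hcc : ⟪χ, φ⟫_ℂ * (starRingEnd ℂ) ⟪χ, φ⟫_ℂ = 1 := by
      rw [Complex.mul_conj, Complex.normSq_eq_norm_sq, hmod]
      simp
    generalize ⟪χ, φ⟫_ℂ = a at hφχ hcc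
    ext x
    rw [hφχ, InnerProductSpace.rankOne_apply, InnerProductSpace.rankOne_apply, inner_smul_left,
      smul_smul, mul_right_comm, mul_comm _ a, hcc, one_mul]
  have hPφ : P φ = 0 := by
    have h := hPx v
    rw [apply_eq_zero_of_le_smul_rankOne hP h₂ hχv] at h
    exact (smul_eq_zero.1 h.symm).resolve_left hφv
  ext x
  rw [hPx x, hPφ, smul_zero, zero_apply]

theorem le_one_of_forall_unit {S : H →L[ℂ] H}
    (h : ∀ ψ, ‖ψ‖ = 1 → ⟪ψ, S ψ⟫_ℂ ≤ 1) : S ≤ 1 := by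
  rw [← sub_nonneg]
  refine nonneg_of_forall_inner fun x => ?_
  by_cases hx : x = 0
  · simp [hx]
  have hn : (‖x‖ : ℂ) ≠ 0 := by simpa using hx
  obtain ⟨ψ, hψ, hxψ⟩ : ∃ ψ : H, ‖ψ‖ = 1 ∧ x = (‖x‖ : ℂ) • ψ :=
    ⟨(‖x‖⁻¹ : ℂ) • x, by simp [norm_smul, hx], by rw [smul_smul, mul_inv_cancel₀ hn, one_smul]⟩
  have hψψ : ⟪ψ, ψ⟫_ℂ = 1 := by simp [inner_self_eq_norm_sq_to_K, hψ]
  have h1 : 0 ≤ ⟪ψ, (1 - S) ψ⟫_ℂ := by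
    rw [sub_apply, one_apply_eq_self, inner_sub_right, hψψ, sub_nonneg]
    exact h ψ hψ
  rw [hxψ, map_smul, inner_smul_left, inner_smul_right, Complex.conj_ofReal]
  have h2 : (0 : ℂ) ≤ ‖x‖ := by exact_mod_cast norm_nonneg x
  positivity

theorem IsPureState.trace_eq_one {ξ : traceClass H} (hξ : IsPureState ξ) :
    trace (ξ : H →L[ℂ] H) = 1 := by
  obtain ⟨φ, hφ, h⟩ := hξ
  rw [h]
  exact (isState_pureState hφ).2

end

end QuantumOp

theorem mainTheorem9 {H : Type u} [NormedAddCommGroup H] [InnerProductSpace ℂ H]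
    [CompleteSpace H] [TopologicalSpace.SeparableSpace H]
    (A B : H →L[ℂ] H) (hA : QuantumOp.IsEffect A) (hB : QuantumOp.IsEffect B)
    (ξ₁ ξ₂ : QuantumOp.traceClass H)
    (hξ₁ : QuantumOp.IsPureState ξ₁) (hξ₂ : QuantumOp.IsPureState ξ₂) (hne : ξ₁ ≠ ξ₂)
    (hco : QuantumOp.Coexistent.{u, v}
      (QuantumOp.preparator A ξ₁) (QuantumOp.preparator B ξ₂)) :
    A + B ≤ 1 := by
  obtain ⟨Ω, _, J, ⟨X, hX, hJX⟩, ⟨Y, hY, hJY⟩⟩ := hco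
  refine QuantumOp.le_one_of_forall_unit fun ψ hψ => ?_
  have hρ := QuantumOp.isState_pureState hψ
  set ρ := QuantumOp.pureState ψ with hρdef
  have hXY : J.toFun (X ∩ Y) ρ = 0 := by
    obtain ⟨φ, hφ, hξφ⟩ := hξ₁
    obtain ⟨χ, hχ, hξχ⟩ := hξ₂
    have h₁ := J.toFun_mono (hX.inter hY) hX Set.inter_subset_left hρ.1
    have h₂ := J.toFun_mono (hX.inter hY) hY Set.inter_subset_right hρ.1
    rw [hJX, QuantumOp.coe_preparator_apply, hξφ] at h₁
    rw [hJY, QuantumOp.coe_preparator_apply, hξχ] at h₂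
    refine Subtype.ext (QuantumOp.eq_zero_of_le_smul_rankOne
      (J.toFun_nonneg (hX.inter hY) hρ.1) hφ hχ (fun h => hne (Subtype.ext ?_)) h₁ h₂)
    rw [hξφ, hξχ, h]
  -- The overlap contributes nothing, so `X \ Y` gives the same output on ρ as `X` and is disjoint
  -- from `Y`.
  have hX' := J.toFun_union (hX.diff hY) (hX.inter hY)
    (Set.disjoint_sdiff_inter (s := X) (t := Y)) ρ
  rw [Set.sdiff_union_inter, hXY, add_zero] at hX'
  have hU := J.toFun_union (hX.diff hY) hY Set.disjoint_sdiff_left ρ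
  rw [← hX', hJX, hJY] at hU
  have h := (J.isOperation _ ((hX.diff hY).union hY)).trace_le_one ρ hρ
  rw [hU, Submodule.coe_add, QuantumOp.trace_add (Subtype.property _) (Subtype.property _), hρdef,
    QuantumOp.trace_preparator_pureState A hξ₁.trace_eq_one,
    QuantumOp.trace_preparator_pureState B hξ₂.trace_eq_one] at h
  rwa [add_apply, inner_add_right]
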